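/- **Setting.** Let $a_1,\dots,a_K\in\mathbb R^d$ be $K\ge 2$ distinct arms and $\theta\in\mathbb R^d$ an unknown parameter such that $\langle\theta,a_i\rangle$ has a unique maximizer $a^*$, and let $\Delta_{\min}=\min_{a_i\ne a^*}\langle\theta,a^*-a_i\rangle$. Let $G=(V,E)$ be a finite non-empty graph whose vertices are the agents. Agent $m$, playing the arm $a$ at time $t$, receives the reward $\langle\theta,a\rangle+\eta_{m,t}$, where the noise variables $\eta_{m,t}$ are independent, centred and $1$-sub-Gaussian, i.e. $\mathbb E\,e^{\lambda\eta_{m,t}}\le e^{\lambda^2/2}$ for all $\lambda\in\mathbb R$. Write $\log$ for the logarithm to base $2$, let $L=\lceil\log K\rceil$, let $T\ge L$ be the time budget of each agent and $b=\lfloor T/L\rfloor$. A *dominating set* of $G$ is a set $D\subseteq V$ such that each vertex outside $D$ has a neighbour in $D$. A corresponding *dominating set partition* is a partition $P$ of $V$ such that each block contains exactly one vertex $v\in D$, its hub, and all other vertices of the block are neighbours of $v$. **MaLinBAI-Star** on a set $B$ of agents. Start with the set $\mathcal A_1$ of all arms. In round $p=1,\dots,L$, replace the active arms $\mathcal A_p$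 by their coordinates in an orthonormal basis of their span (of dimension $d_p$). For a probability distribution $\pi$ on $\mathcal A_p$ put $V(\pi)=\sum_{a}\pi(a)aa^{\top}$ and, if $V(\pi)$ is nonsingular, $g(\pi)=\max_{a\in\mathcal A_p}a^{\top}V(\pi)^{-1}a$. The server chooses a $1$-approximate G-optimal design $\pi_p$, i.e. one with $V(\pi_p)$ nonsingular and $g(\pi_p)\le 2\,g(\pi)$ for every $\pi$ with $V(\pi)$ nonsingular, for which the numbers $b\,\pi_p(a)$ are integers. Each agent in $B$ uses the $b$ time steps of the round to play each arm $a\in\mathcal A_p$ exactly $b\,\pi_p(a)$ times, in an order fixed in advance. From the plays $a_s$ and rewards $r_s$ of all agents in $B$ in this round the server computes $V_B=\sum_s a_sa_s^{\top}$, $D_B=\sum_s r_sa_s$, $\hat\theta=V_B^{-1}D_B$ and the estimates $x_p(a)=\hat\theta^{\top}a$, and lets $\mathcal A_{p+1}$ consist of $\lceil K/2^p\rceil$ arms of $\mathcal A_p$ with the highest estimates (ties are broken by any measurable rule). The run returns the only arm $a$ of $\mathcal A_{L+1}$, with its variance $a^{\top}V_B^{-1}a$ in round $L$. **MaLinBAI-Gen.**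 Given a dominating set partition $P$ of $G$, each block of $P$ runs MaLinBAI-Star separately, its agents being all vertices of the block, the hub included. The top-level server outputs the arm returned by the largest number of blocks; if several arms are tied, it outputs among them one for which the smallest variance was reported. **Theorem.** For every finite non-empty graph $G$, every dominating set partition $P$ of $G$ and every such run of MaLinBAI-Gen, $$\Pr[\text{the output is not } a^*]\;\le\;8\log K\,\exp\left\{\frac{-T\,\Delta_{\min}^2}{32\,d\log K}\right\}.$$ In particular the bound does not depend on the number of blocks of $P$. -/

import Mathlib

open scoped Matrix

noncomputable section

namespace MaLinBAI

/-! ### Networks -/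

section Network

variable {V : Type*} [Fintype V] [DecidableEq V]

/-- `D` is a dominating set of `G`: every vertex outside `D` has a neighbour in `D`. -/
def IsDominatingSet (G : SimpleGraph V) (D : Finset V) : Prop :=
  ∀ u, u ∉ D → ∃ v ∈ D, G.Adj v u

/-- `P` is a dominating set partition of `G` for the dominating set `D`: each block contains
exactly one vertex of `D` (its hub), and all its other vertices are neighbours of the hub. -/
def IsDominatingSetPartition (G : SimpleGraph V) (D : Finset V)
    (P : Finpartition (Finset.univ : Finset V)) : Prop :=
  IsDominatingSet G D ∧
    ∀ B ∈ P.parts, ∃ v, B ∩ D = {v} ∧ ∀ u ∈ B, u ≠ v → G.Adj v u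

end Network

/-! ### Parameters of the algorithm -/

/-- The number of rounds, `⌈log₂ K⌉`. -/
def rounds (K : ℕ) : ℕ := ⌈Real.logb 2 K⌉₊

/-- The budget of one round, `⌊T / ⌈log₂ K⌉⌋`. -/
def roundBudget (K T : ℕ) : ℕ := T / rounds K

/-- The number `⌈K / 2 ^ p⌉` of arms that are still active after `p` rounds. -/
def activeCard (K p : ℕ) : ℕ := ⌈(K : ℝ) / 2 ^ p⌉₊

/-! ### Projected arms and G-optimal designs -/

section Design

variable {d K : ℕ} (a : Fin K → EuclideanSpace ℝ (Fin d)) (S : Finset (Fin K))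

/-- The span of the arms with index in `S`. -/
def armSpan : Submodule ℝ (EuclideanSpace ℝ (Fin d)) := Submodule.span ℝ (a '' (S : Set (Fin K)))

/-- The rank of the arms with index in `S`. -/
def armRank : ℕ := Module.finrank ℝ (armSpan a S)

/-- The projection of the `i`-th arm to `armRank a S` dimensions: its coordinates in an orthonormal
basis of the span of the arms with index in `S`. -/
def projArm (i : Fin K) : Fin (armRank a S) → ℝ := fun k =>
  inner ℝ ((stdOrthonormalBasis ℝ (armSpan a S) k : armSpan a S) : EuclideanSpace ℝ (Fin d)) (a i)

/-- `V(π) = ∑ π(a) a aᵀ` for the projected arms. -/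
def designMatrix (w : Fin K → ℝ) : Matrix (Fin (armRank a S)) (Fin (armRank a S)) ℝ :=
  ∑ i ∈ S, w i • Matrix.vecMulVec (projArm a S i) (projArm a S i)

/-- `aᵀ A⁻¹ a` for the `i`-th projected arm. -/
def armNormSq (A : Matrix (Fin (armRank a S)) (Fin (armRank a S)) ℝ) (i : Fin K) : ℝ :=
  projArm a S i ⬝ᵥ (A⁻¹ *ᵥ projArm a S i)

/-- `g(π)`, the maximum over the active arms of `aᵀ V(π)⁻¹ a`. -/
def gValue (w : Fin K → ℝ) : ℝ := ⨆ i : S, armNormSq a S (designMatrix a S w) i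

/-- A probability distribution on the arms in `S` whose matrix `V(π)` is nonsingular. -/
structure IsDesign (w : Fin K → ℝ) : Prop where
  nonneg : ∀ i, 0 ≤ w i
  eq_zero : ∀ i, i ∉ S → w i = 0
  sum_eq_one : ∑ i ∈ S, w i = 1
  nonsingular : IsUnit (designMatrix a S w).det

/-- An `ε`-approximate solution of the G-optimal design problem on `S`: a design whose value `g` is
at most `1 + ε` times that of any other design. -/
def IsApproxGOptimal (ε : ℝ) (w : Fin K → ℝ) : Prop :=
  IsDesign a S w ∧ ∀ w', IsDesign a S w' → gValue a S w ≤ (1 + ε) * gValue a S w'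

end Design

/-! ### MaLinBAI-Star -/

/-- The choices that the description of MaLinBAI-Star leaves open. Rounds are numbered from `0`, and
the conditions are imposed only on sets `S` that can be active in the given round. -/
structure StarRules (V : Type*) {d K : ℕ} (a : Fin K → EuclideanSpace ℝ (Fin d)) (T : ℕ) where
  /-- The design that the server computes in round `p` on the active set `S`. -/
  design : ℕ → Finset (Fin K) → Fin K → ℝ
  /-- `play m p S s` is the arm that agent `m` plays in step `s` of round `p`. -/
  play : V → ℕ → Finset (Fin K) → Fin (roundBudget K T) → Fin K
  /-- The set of arms kept at the end of round `p`, given the active set and the estimates. -/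
  keep : ℕ → Finset (Fin K) → (Fin K → ℝ) → Finset (Fin K)
  /-- The design is a `1`-approximate G-optimal design. -/
  design_spec : ∀ p < rounds K, ∀ S : Finset (Fin K), S.card = activeCard K p →
    IsApproxGOptimal a S 1 (design p S)
  /-- Each agent plays each arm exactly `b π(a)` times, in some order. -/
  play_spec : ∀ p < rounds K, ∀ S : Finset (Fin K), S.card = activeCard K p → ∀ m i,
    ((Finset.univ.filter fun s => play m p S s = i).card : ℝ) = roundBudget K T * design p S i
  /-- The kept arms are active. -/
  keep_subset : ∀ p < rounds K, ∀ S : Finset (Fin K), S.card = activeCard K p → ∀ x,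
    keep p S x ⊆ S
  /-- In the `p`-th round (from `0`), `⌈K / 2 ^ (p + 1)⌉` arms are kept. -/
  keep_card : ∀ p < rounds K, ∀ S : Finset (Fin K), S.card = activeCard K p → ∀ x,
    (keep p S x).card = activeCard K (p + 1)
  /-- The kept arms have the highest estimates; ties are broken by any measurable rule. -/
  keep_top : ∀ p < rounds K, ∀ S : Finset (Fin K), S.card = activeCard K p → ∀ x,
    ∀ i ∈ keep p S x, ∀ j ∈ S, j ∉ keep p S x → x j ≤ x i
  keep_measurable : ∀ p S S', MeasurableSet {x : Fin K → ℝ | keep p S x = S'}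

section Star

variable {V : Type*} {d K T : ℕ} {a : Fin K → EuclideanSpace ℝ (Fin d)} {Ω : Type*}
variable (R : StarRules V a T) (θ : EuclideanSpace ℝ (Fin d)) (η : V → ℕ → Ω → ℝ)

/-- The reward of agent `m` for step `s` of round `p`. This step takes place at time
`p * b + s` (time starts at `0`), where `b` is the budget of a round. -/
def reward (p : ℕ) (S : Finset (Fin K)) (m : V) (s : Fin (roundBudget K T)) (ω : Ω) : ℝ :=
  inner ℝ θ (a (R.play m p S s)) + η m (p * roundBudget K T + s) ω

/-- The matrix `V_m` of agent `m`, in the projected coordinates. -/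
def agentV (p : ℕ) (S : Finset (Fin K)) (m : V) :
    Matrix (Fin (armRank a S)) (Fin (armRank a S)) ℝ :=
  ∑ s, Matrix.vecMulVec (projArm a S (R.play m p S s)) (projArm a S (R.play m p S s))

/-- The vector `D_m` of agent `m`, in the projected coordinates. -/
def agentD (p : ℕ) (S : Finset (Fin K)) (m : V) (ω : Ω) : Fin (armRank a S) → ℝ :=
  ∑ s, reward R θ η p S m s ω • projArm a S (R.play m p S s)

/-- The aggregated matrix of the server of the block `B` in round `p`. -/
def serverV (B : Finset V) (p : ℕ) (S : Finset (Fin K)) :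
    Matrix (Fin (armRank a S)) (Fin (armRank a S)) ℝ :=
  ∑ m ∈ B, agentV R p S m

/-- The aggregated vector of the server of the block `B` in round `p`. -/
def serverD (B : Finset V) (p : ℕ) (S : Finset (Fin K)) (ω : Ω) : Fin (armRank a S) → ℝ :=
  ∑ m ∈ B, agentD R θ η p S m ω

/-- The least-squares estimate of the block `B` in round `p`, in the projected coordinates. -/
def thetaHat (B : Finset V) (p : ℕ) (S : Finset (Fin K)) (ω : Ω) : Fin (armRank a S) → ℝ :=
  (serverV R B p S)⁻¹ *ᵥ serverD R θ η B p S ω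

/-- The estimated expected reward of the arms in round `p`. -/
def estimate (B : Finset V) (p : ℕ) (S : Finset (Fin K)) (ω : Ω) (i : Fin K) : ℝ :=
  thetaHat R θ η B p S ω ⬝ᵥ projArm a S i

/-- The active set of the run of MaLinBAI-Star by the agents in `B`, after `p` rounds. -/
def active (B : Finset V) : ℕ → Ω → Finset (Fin K)
  | 0, _ => Finset.univ
  | p + 1, ω => R.keep p (active B p ω) (estimate R θ η B p (active B p ω) ω)

/-- The run of MaLinBAI-Star by the agents in `B` returns the arm `i`, the only one left. -/
def StarReturns (B : Finset V) (ω : Ω) (i : Fin K) : Prop :=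
  active R θ η B (rounds K) ω = {i}

/-- The variance `aᵀ V⁻¹ a` of the `i`-th arm that is computed by the block `B` in the last round. -/
def starVariance (B : Finset V) (ω : Ω) (i : Fin K) : ℝ :=
  armNormSq a (active R θ η B (rounds K - 1) ω)
    (serverV R B (rounds K - 1) (active R θ η B (rounds K - 1) ω)) i

end Star

/-! ### MaLinBAI-Gen -/

section Gen

variable {V : Type*} [Fintype V] [DecidableEq V] {d K T : ℕ}
  {a : Fin K → EuclideanSpace ℝ (Fin d)} {Ω : Type*}
variable {P : Finpartition (Finset.univ : Finset V)} (R : P.parts → StarRules V a T)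
  (θ : EuclideanSpace ℝ (Fin d)) (η : V → ℕ → Ω → ℝ)

open Classical in
/-- The number of blocks that return the arm `i`. -/
def votes (ω : Ω) (i : Fin K) : ℕ :=
  (Finset.univ.filter fun B : P.parts => StarReturns (R B) θ η (B : Finset V) ω i).card

/-- The arm `i` is returned by a maximal number of blocks. -/
def MostFrequent (ω : Ω) (i : Fin K) : Prop :=
  ∀ j, votes R θ η ω j ≤ votes R θ η ω i

/-- `i` is a legitimate output of the top-level server: it is a most frequent arm, and among the
variances that the blocks report for most frequent arms, the smallest one is reported for `i`. -/
def IsGenOutput (ω : Ω) (i : Fin K) : Prop :=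
  MostFrequent R θ η ω i ∧
    ∃ B : P.parts, StarReturns (R B) θ η (B : Finset V) ω i ∧
      ∀ (B' : P.parts) (j : Fin K), StarReturns (R B') θ η (B' : Finset V) ω j →
        MostFrequent R θ η ω j →
          starVariance (R B) θ η (B : Finset V) ω i ≤ starVariance (R B') θ η (B' : Finset V) ω j

end Gen

/-- The minimum sub-optimality gap, where `best` is the index of the best arm. -/
def minGap {d K : ℕ} (a : Fin K → EuclideanSpace ℝ (Fin d)) (θ : EuclideanSpace ℝ (Fin d))
    (best : Fin K) : ℝ :=
  ⨅ i : {i : Fin K // i ≠ best}, inner ℝ θ (a best - a i)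

end MaLinBAI

end

namespace MaLinBAI

/-! ### The Kiefer–Wolfowitz bound -/

/-! Write ρ for the exponential in the bound. In a fixed round with a fixed active set `S`, the
estimated difference between a suboptimal arm and `best` is the true difference plus a weighted sum
of the noise. By Kiefer–Wolfowitz and the parallelogram bound the variance proxy of that sum is at
most `8 * d / b`, where `b` is the round budget. With `T ≤ 2 * b * logb 2 K` the sub-Gaussian tail
is then at most ρ (`measureReal_estimate_le_estimate`). The budget inequality can fail only for `b =
1`. There the design sits on one arm, all active arms are multiples of it, and a direct comparison
of variance and gap replaces the general one (`noise_variance_le`).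

The active set depends on past noise and the estimates for a fixed `S` on the noise of the current
round, so by independence one may argue for each `S` separately. If `best` is dropped, all `n` kept
arms are estimated at least as high. There are at most `2 * n` candidates, so Markov's inequality
for their number gives `2 * ρ` per round (`measureReal_eliminated_le`). At most `2 * logb 2 K`
rounds give `4 * logb 2 K * ρ` per block.

A wrong output forces at least half of the blocks to fail. Markov's inequality for the number of
failing blocks costs a factor 2, whatever the number of blocks and without independence between
them. -/

theorem le_of_forall_one_add_mul_le_pow {x : ℝ} {r : ℕ}
    (h : ∀ s : ℝ, 0 ≤ s → 1 + s * x ≤ (1 + s) ^ r) : x ≤ r := by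
  -- This function vanishes at 0 and is nonnegative to the right of it, so its derivative there is
  -- nonnegative.
  have h1 : HasDerivAt (fun s : ℝ => (1 + s) ^ r - 1 - s * x) (r - x) 0 := by
    have := ((((hasDerivAt_id (0 : ℝ)).const_add 1).pow r).sub_const 1).sub
      ((hasDerivAt_id (0 : ℝ)).mul_const x)
    convert! this using 1
    simp
  have h2 := h1.hasDerivWithinAt (s := Set.Ioi 0)
  rw [hasDerivWithinAt_iff_tendsto_slope' (by simp)] at h2
  have h3 : (0 : ℝ) ≤ r - x := by
    refine ge_of_tendsto h2 ?_
    filter_upwards [self_mem_nhdsWithin] with s hs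
    have hs' : (0 : ℝ) < s := hs
    rw [slope_def_field]
    refine div_nonneg ?_ (by simpa using hs'.le)
    have := h s hs'.le
    simp
    linarith
  linarith

/-- This turns maximality of the determinant among designs into a bound on `armNormSq`. -/
theorem det_add_smul_vecMulVec {n : Type*} [Fintype n] [DecidableEq n] {A : Matrix n n ℝ}
    (hA : IsUnit A.det) (v : n → ℝ) (s : ℝ) :
    (A + s • Matrix.vecMulVec v v).det = A.det * (1 + s * (v ⬝ᵥ (A⁻¹ *ᵥ v))) := by
  have h := Matrix.det_add_replicateCol_mul_replicateRow (ι := Unit) hA (s • v) v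
  have e : s • Matrix.vecMulVec v v
      = Matrix.replicateCol Unit (s • v) * Matrix.replicateRow Unit v := by
    rw [← Matrix.vecMulVec_eq, Matrix.smul_vecMulVec]
  rw [e, h]
  congr 1
  rw [Matrix.det_unique]
  simp only [Matrix.add_apply, Matrix.one_apply_eq]
  congr 1
  rw [Matrix.mul_assoc, Matrix.mul_apply']
  change v ⬝ᵥ (A⁻¹ *ᵥ (s • v)) = _
  rw [Matrix.mulVec_smul, dotProduct_smul, smul_eq_mul]

section Design

variable {d K : ℕ} (a : Fin K → EuclideanSpace ℝ (Fin d)) (S : Finset (Fin K))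

theorem posSemidef_designMatrix {w : Fin K → ℝ} (hw : ∀ i, 0 ≤ w i) :
    (designMatrix a S w).PosSemidef := by
  refine Matrix.posSemidef_sum _ fun i _ => ?_
  have := Matrix.posSemidef_vecMulVec_self_star (projArm a S i)
  rw [star_trivial] at this
  exact this.smul (hw i)

theorem IsDesign.posDef {w : Fin K → ℝ} (hw : IsDesign a S w) : (designMatrix a S w).PosDef :=
  (posSemidef_designMatrix a S hw.nonneg).posDef_iff_det_ne_zero.2 hw.nonsingular.ne_zero

theorem continuous_det_designMatrix : Continuous fun w => (designMatrix a S w).det := by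
  refine Continuous.matrix_det ?_
  unfold designMatrix
  fun_prop

theorem isCompact_weights :
    IsCompact {w : Fin K → ℝ | (∀ i, 0 ≤ w i) ∧ (∀ i, i ∉ S → w i = 0) ∧ ∑ i ∈ S, w i = 1} := by
  refine IsCompact.of_isClosed_subset (isCompact_Icc (a := (0 : Fin K → ℝ)) (b := 1)) ?_ ?_
  · refine IsClosed.inter ?_ (IsClosed.inter ?_ ?_)
    · exact isClosed_le continuous_const continuous_id
    · change IsClosed {w : Fin K → ℝ | ∀ i, i ∉ S → w i = 0}
      have : IsClosed (⋂ i ∈ {i | i ∉ S}, {w : Fin K → ℝ | w i = 0}) :=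
        isClosed_biInter fun i _ => isClosed_eq (continuous_apply i) continuous_const
      convert! this using 1
      ext w
      simp
    · exact isClosed_eq (by fun_prop) continuous_const
  · rintro w ⟨h0, hS, h1⟩
    refine ⟨h0, fun i => ?_⟩
    by_cases hi : i ∈ S
    · exact (Finset.single_le_sum (fun j _ => h0 j) hi).trans_eq h1
    · simp [hS i hi]

/-- **Kiefer–Wolfowitz**: if there is a design, then there is one with `g ≤ armRank`. -/
theorem exists_isDesign_armNormSq_le {w₀ : Fin K → ℝ} (hw₀ : IsDesign a S w₀) :
    ∃ w, IsDesign a S w ∧ ∀ i ∈ S, armNormSq a S (designMatrix a S w) i ≤ armRank a S := by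
  -- The witness is a D-optimal design: it maximizes the determinant over the compact simplex. The
  -- given design `w₀` ensures that the maximum is positive.
  obtain ⟨w, ⟨hw0, hwS, hw1⟩, hmax⟩ := (isCompact_weights S).exists_isMaxOn
    ⟨w₀, hw₀.nonneg, hw₀.eq_zero, hw₀.sum_eq_one⟩ (continuous_det_designMatrix a S).continuousOn
  have hdet : 0 < (designMatrix a S w).det :=
    hw₀.posDef.det_pos.trans_le (hmax ⟨hw₀.nonneg, hw₀.eq_zero, hw₀.sum_eq_one⟩)
  refine ⟨w, ⟨hw0, hwS, hw1, hdet.ne'.isUnit⟩, fun i hi => ?_⟩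
  refine le_of_forall_one_add_mul_le_pow fun s hs => ?_
  have hs1 : 0 < 1 + s := by linarith
  -- Move mass towards arm `i`. Maximality then reads `1 + s * armNormSq ≤ (1 + s) ^ armRank`, the
  -- power coming from the scalar `(1 + s)⁻¹` in the determinant.
  have hmem : (1 + s)⁻¹ • (w + s • Pi.single i 1) ∈
      {w : Fin K → ℝ | (∀ i, 0 ≤ w i) ∧ (∀ i, i ∉ S → w i = 0) ∧ ∑ i ∈ S, w i = 1} := by
    refine ⟨fun j => ?_, fun j hj => ?_, ?_⟩
    · have : (0 : ℝ) ≤ (Pi.single i 1 : Fin K → ℝ) j := by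
        rw [Pi.single_apply]; split_ifs <;> norm_num
      have := hw0 j
      simp only [Pi.smul_apply, Pi.add_apply, smul_eq_mul]
      positivity
    · have hji : j ≠ i := fun h => hj (h ▸ hi)
      simp [hwS j hj, hji]
    · simp only [Pi.smul_apply, Pi.add_apply, smul_eq_mul, ← Finset.mul_sum,
        Finset.sum_add_distrib, hw1]
      rw [Finset.sum_eq_single_of_mem i hi fun j _ hj => by simp [hj], Pi.single_eq_same, mul_one,
        inv_mul_cancel₀ hs1.ne']
  have hmat : designMatrix a S ((1 + s)⁻¹ • (w + s • Pi.single i 1)) =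
      (1 + s)⁻¹ • (designMatrix a S w
        + s • Matrix.vecMulVec (projArm a S i) (projArm a S i)) := by
    unfold designMatrix
    simp only [Pi.smul_apply, Pi.add_apply, smul_eq_mul, mul_smul, add_smul,
      Finset.sum_add_distrib, ← Finset.smul_sum]
    congr 3
    rw [Finset.sum_eq_single_of_mem i hi fun j _ hj => by simp [hj]]
    simp
  have h := hmax hmem
  simp only [Set.mem_ofPred_eq] at h
  rw [hmat, Matrix.det_smul, det_add_smul_vecMulVec hdet.ne'.isUnit, Fintype.card_fin, inv_pow,
    inv_mul_le_iff₀ (by positivity), mul_comm] at h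
  exact le_of_mul_le_mul_right h hdet

theorem armNormSq_le_gValue (w : Fin K → ℝ) {i : Fin K} (hi : i ∈ S) :
    armNormSq a S (designMatrix a S w) i ≤ gValue a S w :=
  le_ciSup (f := fun i : S => armNormSq a S (designMatrix a S w) i)
    (Set.finite_range _).bddAbove ⟨i, hi⟩

theorem IsApproxGOptimal.armNormSq_le {w : Fin K → ℝ} (hw : IsApproxGOptimal a S 1 w)
    {i : Fin K} (hi : i ∈ S) :
    armNormSq a S (designMatrix a S w) i ≤ 2 * armRank a S := by
  obtain ⟨w', hw', hle⟩ := exists_isDesign_armNormSq_le a S hw.1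
  have : Nonempty S := ⟨⟨i, hi⟩⟩
  have hg : gValue a S w' ≤ armRank a S := ciSup_le fun j => hle j j.2
  have := (armNormSq_le_gValue a S w hi).trans (hw.2 w' hw')
  linarith

/-! ### Coordinates in the span of the active arms -/

theorem armRank_le : armRank a S ≤ d := by
  simpa [armRank] using Submodule.finrank_le (armSpan a S)

/-- The coordinates of the projection of `θ` to the span of the arms in `S`. -/
noncomputable def projParam (θ : EuclideanSpace ℝ (Fin d)) : Fin (armRank a S) → ℝ := fun k =>
  inner ℝ ((stdOrthonormalBasis ℝ (armSpan a S) k : armSpan a S) : EuclideanSpace ℝ (Fin d)) θ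

theorem inner_eq_dotProduct (θ : EuclideanSpace ℝ (Fin d)) {i : Fin K} (hi : i ∈ S) :
    inner ℝ θ (a i) = projParam a S θ ⬝ᵥ projArm a S i := by
  have hmem : a i ∈ armSpan a S := Submodule.subset_span ⟨i, hi, rfl⟩
  have h := congrArg (fun v : armSpan a S => (v : EuclideanSpace ℝ (Fin d)))
    ((stdOrthonormalBasis ℝ (armSpan a S)).sum_repr' ⟨a i, hmem⟩)
  simp only [Submodule.coe_sum, Submodule.coe_smul, Submodule.coe_inner] at h
  rw [← h, inner_sum]
  refine Finset.sum_congr rfl fun k _ => ?_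
  rw [inner_smul_right, mul_comm, real_inner_comm]
  rfl

end Design

/-- The parallelogram bound for a positive semidefinite quadratic form. -/
theorem dotProduct_sub_le {n : Type*} [Fintype n] {A : Matrix n n ℝ} (hA : A.PosSemidef)
    (u v : n → ℝ) :
    (u - v) ⬝ᵥ (A *ᵥ (u - v)) ≤ 2 * (u ⬝ᵥ (A *ᵥ u) + v ⬝ᵥ (A *ᵥ v)) := by
  have h := hA.dotProduct_mulVec_nonneg (u + v)
  rw [star_trivial] at h
  simp only [Matrix.mulVec_add, Matrix.mulVec_sub, add_dotProduct, dotProduct_add, sub_dotProduct,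
    dotProduct_sub] at h ⊢
  linarith

/-! ### Parameters -/

theorem one_le_logb {K : ℕ} (hK : 2 ≤ K) : 1 ≤ Real.logb 2 K := by
  rw [Real.le_logb_iff_rpow_le (by norm_num) (by positivity)]
  simpa using (by exact_mod_cast hK : (2 : ℝ) ≤ K)

theorem rounds_pos {K : ℕ} (hK : 2 ≤ K) : 0 < rounds K :=
  Nat.ceil_pos.2 (zero_lt_one.trans_le (one_le_logb hK))

theorem rounds_lt {K : ℕ} (hK : 2 ≤ K) : (rounds K : ℝ) < Real.logb 2 K + 1 :=
  Nat.ceil_lt_add_one (zero_le_one.trans (one_le_logb hK))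

theorem rounds_le {K : ℕ} (hK : 2 ≤ K) : (rounds K : ℝ) ≤ 2 * Real.logb 2 K := by
  linarith [rounds_lt hK, one_le_logb hK]

/-- This is `2 ^ 3 ≤ 3 ^ 2`. It settles the case of two rounds in `budget_bound`, where `T ≤ 2 * b +
1 ≤ 3 * b`. -/
theorem three_halves_le_logb {K : ℕ} (hK : 3 ≤ K) : 3 / 2 ≤ Real.logb 2 K := by
  have h : (0 : ℝ) < K := by positivity
  have h2 : 3 ≤ Real.logb 2 ((K : ℝ) ^ 2) := by
    rw [Real.le_logb_iff_rpow_le (by norm_num) (by positivity)]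
    have : (3 : ℝ) ≤ K := by exact_mod_cast hK
    norm_num
    nlinarith
  rw [Real.logb_pow] at h2
  push_cast at h2
  linarith

theorem roundBudget_pos {K T : ℕ} (hK : 2 ≤ K) (hT : rounds K ≤ T) : 0 < roundBudget K T :=
  Nat.div_pos hT (rounds_pos hK)

theorem lt_roundBudget_add_one_mul {K : ℕ} (T : ℕ) (hK : 2 ≤ K) :
    T < (roundBudget K T + 1) * rounds K := by
  rw [mul_comm]
  exact Nat.lt_mul_div_succ T (rounds_pos hK)

/-- Outside of the case `b = 1`, the budget of a round is at least `T / (2 log K)`. In that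
exceptional case a slightly weaker bound holds. -/
theorem budget_bound {K T : ℕ} (hK : 2 ≤ K) (hT : rounds K ≤ T) :
    (T : ℝ) ≤ 2 * roundBudget K T * Real.logb 2 K ∨
      roundBudget K T = 1 ∧ 6 * (T : ℝ) ≤ 16 * Real.logb 2 K := by
  have hb := roundBudget_pos hK hT
  have hlt := lt_roundBudget_add_one_mul T hK
  have hL := rounds_lt hK
  have hlog := one_le_logb hK
  have hT' : (T : ℝ) + 1 ≤ (roundBudget K T + 1) * rounds K := by exact_mod_cast hlt
  have hb' : (1 : ℝ) ≤ roundBudget K T := by exact_mod_cast hb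
  set b := roundBudget K T with hbdef
  have hLpos := rounds_pos hK
  rcases Nat.lt_or_ge (rounds K) 3 with h3 | h3
  · left
    rcases Nat.lt_or_ge K 3 with hK3 | hK3
    · obtain rfl : K = 2 := by omega
      have h1 : rounds 2 = 1 := by simp [rounds]
      rw [h1] at hT'
      push_cast at *
      nlinarith
    · have h32 := three_halves_le_logb hK3
      have : (rounds K : ℝ) ≤ 2 := by exact_mod_cast Nat.lt_succ_iff.1 h3
      nlinarith
  · have h3' : (3 : ℝ) ≤ rounds K := by exact_mod_cast h3
    rcases Nat.lt_or_ge b 2 with h2 | h2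
    · right
      have hb1 : b = 1 := by omega
      refine ⟨hb1, ?_⟩
      rw [hb1] at hT'
      push_cast at hT'
      linarith
    · left
      have h2' : (2 : ℝ) ≤ b := by exact_mod_cast h2
      -- With `L` rounds and `L - 1 < logb 2 K`, it suffices that `(b + 1) * L - 1 ≤ 2 * b * (L -
      -- 1)`, that is `1 ≤ (b - 1) * (L - 2)`.
      nlinarith [mul_nonneg (sub_nonneg.2 h2') (sub_nonneg.2 h3')]

theorem activeCard_zero (K : ℕ) : activeCard K 0 = K := by simp [activeCard]

theorem activeCard_rounds {K : ℕ} (hK : 2 ≤ K) : activeCard K (rounds K) = 1 := by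
  have hK0 : (0 : ℝ) < K := by positivity
  have h : (K : ℝ) ≤ 2 ^ rounds K := by
    have := Nat.le_ceil (Real.logb 2 K)
    rw [Real.logb_le_iff_le_rpow (by norm_num) hK0, Real.rpow_natCast] at this
    exact this
  unfold activeCard
  rw [Nat.ceil_eq_iff one_ne_zero]
  constructor
  · simp only [Nat.sub_self, Nat.cast_zero]; positivity
  · rw [div_le_iff₀ (by positivity)]; simpa using h

theorem activeCard_le_two_mul (K p : ℕ) : activeCard K p ≤ 2 * activeCard K (p + 1) := by
  refine Nat.ceil_le.2 ?_
  have := Nat.le_ceil ((K : ℝ) / 2 ^ (p + 1))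
  have e : (K : ℝ) / 2 ^ p = 2 * ((K : ℝ) / 2 ^ (p + 1)) := by
    rw [pow_succ]; field_simp
  rw [e, Nat.cast_mul, Nat.cast_ofNat]
  exact mul_le_mul_of_nonneg_left this (by norm_num)

theorem activeCard_pos {K : ℕ} (hK : 2 ≤ K) (p : ℕ) : 0 < activeCard K p :=
  Nat.ceil_pos.2 (by positivity)

/-! ### The gap -/

section Gap

variable {d K : ℕ} (a : Fin K → EuclideanSpace ℝ (Fin d)) (θ : EuclideanSpace ℝ (Fin d))
  (best : Fin K)

theorem minGap_le {i : Fin K} (hi : i ≠ best) :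
    minGap a θ best ≤ inner ℝ θ (a best) - inner ℝ θ (a i) := by
  rw [← inner_sub_right]
  exact ciInf_le (Set.finite_range _).bddBelow (⟨i, hi⟩ : {i : Fin K // i ≠ best})

theorem minGap_pos (hK : 2 ≤ K) (hbest : ∀ i, i ≠ best → inner ℝ θ (a i) < inner ℝ θ (a best)) :
    0 < minGap a θ best := by
  have : Nontrivial (Fin K) := Fin.nontrivial_iff_two_le.2 hK
  obtain ⟨j, hj⟩ := exists_ne best
  have : Nonempty {i : Fin K // i ≠ best} := ⟨⟨j, hj⟩⟩
  obtain ⟨i, hi⟩ := exists_eq_ciInf_of_finite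
    (f := fun i : {i : Fin K // i ≠ best} => (inner ℝ θ (a best - a i) : ℝ))
  rw [minGap, ← hi, inner_sub_right, sub_pos]
  exact hbest i i.2

end Gap

/-! ### Estimates -/

section Star

variable {V : Type*} {d K T : ℕ} {a : Fin K → EuclideanSpace ℝ (Fin d)} {Ω : Type*}
  (R : StarRules V a T) (θ : EuclideanSpace ℝ (Fin d)) (η : V → ℕ → Ω → ℝ)
  {p : ℕ} (hp : p < rounds K) {S : Finset (Fin K)} (hS : S.card = activeCard K p)

include hp hS

/-- The play counts realize the design exactly, so there is no rounding loss and all agents have the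
same matrix. -/
theorem agentV_eq (m : V) :
    agentV R p S m = (roundBudget K T : ℝ) • designMatrix a S (R.design p S) := by
  unfold agentV designMatrix
  rw [Finset.sum_comp (fun i => Matrix.vecMulVec (projArm a S i) (projArm a S i))
      (fun s => R.play m p S s),
    Finset.sum_subset (Finset.subset_univ _) (fun i _ hi => ?_),
    ← Finset.sum_subset (Finset.subset_univ S) (fun i _ hi => ?_), Finset.smul_sum]
  · refine Finset.sum_congr rfl fun i _ => ?_
    rw [smul_smul, ← R.play_spec p hp S hS m i, Nat.cast_smul_eq_nsmul]
  · have h := R.play_spec p hp S hS m i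
    rw [(R.design_spec p hp S hS).1.eq_zero i hi, mul_zero, Nat.cast_eq_zero] at h
    rw [h, zero_smul]
  · rw [Finset.card_eq_zero.2, zero_smul]
    refine Finset.filter_eq_empty_iff.2 fun s _ hs => hi ?_
    exact Finset.mem_image.2 ⟨s, Finset.mem_univ _, hs⟩

theorem serverV_eq (B : Finset V) :
    serverV R B p S =
      ((B.card : ℝ) * roundBudget K T) • designMatrix a S (R.design p S) := by
  unfold serverV
  rw [Finset.sum_congr rfl fun m _ => agentV_eq R hp hS m, Finset.sum_const,
    ← Nat.cast_smul_eq_nsmul ℝ, smul_smul]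

theorem play_mem (m : V) (s : Fin (roundBudget K T)) :
    R.play m p S s ∈ S := by
  by_contra h
  have h' := R.play_spec p hp S hS m (R.play m p S s)
  rw [(R.design_spec p hp S hS).1.eq_zero _ h, mul_zero, Nat.cast_eq_zero,
    Finset.card_eq_zero] at h'
  exact Finset.filter_eq_empty_iff.1 h' (Finset.mem_univ s) rfl

theorem isUnit_det_serverV (hb : 0 < roundBudget K T) {B : Finset V} (hB : B.Nonempty) :
    IsUnit (serverV R B p S).det := by
  rw [serverV_eq R hp hS, Matrix.det_smul]
  have := hB.card_pos
  exact ((by positivity : (((B.card : ℝ) * roundBudget K T) ^ _) ≠ 0).isUnit).mul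
    (R.design_spec p hp S hS).1.nonsingular

omit hp hS in
theorem serverV_transpose (B : Finset V) : (serverV R B p S)ᵀ = serverV R B p S := by
  simp [serverV, agentV, Matrix.transpose_sum, Matrix.transpose_vecMulVec]

theorem serverD_eq (B : Finset V) (ω : Ω) :
    serverD R θ η B p S ω = serverV R B p S *ᵥ projParam a S θ +
      ∑ m ∈ B, ∑ s : Fin (roundBudget K T),
        η m (p * roundBudget K T + s) ω • projArm a S (R.play m p S s) := by
  unfold serverD serverV agentD agentV reward
  rw [Matrix.sum_mulVec, ← Finset.sum_add_distrib]
  refine Finset.sum_congr rfl fun m _ => ?_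
  rw [Matrix.sum_mulVec, ← Finset.sum_add_distrib]
  refine Finset.sum_congr rfl fun s _ => ?_
  rw [inner_eq_dotProduct a S θ (play_mem R hp hS m s), add_smul, Matrix.vecMulVec_mulVec,
    dotProduct_comm]
  simp

/-- The coefficient of the noise of agent `m` in step `s` in the estimated difference between the
arms `j` and `i`. -/
noncomputable def noiseCoeff {V : Type*} {d K T : ℕ} {a : Fin K → EuclideanSpace ℝ (Fin d)}
    (R : StarRules V a T) (p : ℕ) (S : Finset (Fin K)) (B : Finset V) (j i : Fin K)
    (m : V) (s : Fin (roundBudget K T)) : ℝ :=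
  projArm a S (R.play m p S s) ⬝ᵥ ((serverV R B p S)⁻¹ *ᵥ (projArm a S j - projArm a S i))

/-- Least squares is unbiased here: the signal part of `serverD` is `serverV` applied to the
projected parameter. Symmetry of the inverse moves it from the noise vector to the arm difference.
-/
theorem estimate_sub_estimate (hb : 0 < roundBudget K T) {B : Finset V} (hB : B.Nonempty)
    {i j : Fin K} (hi : i ∈ S) (hj : j ∈ S) (ω : Ω) :
    estimate R θ η B p S ω j - estimate R θ η B p S ω i =
      inner ℝ θ (a j) - inner ℝ θ (a i) + ∑ m ∈ B, ∑ s : Fin (roundBudget K T),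
        noiseCoeff R p S B j i m s * η m (p * roundBudget K T + s) ω := by
  have hu := isUnit_det_serverV R hp hS hb hB
  have hsymm : ((serverV R B p S)⁻¹)ᵀ = (serverV R B p S)⁻¹ := by
    rw [Matrix.transpose_nonsing_inv, serverV_transpose]
  unfold estimate thetaHat
  rw [← dotProduct_sub, serverD_eq R θ η hp hS, Matrix.mulVec_add, Matrix.mulVec_mulVec,
    Matrix.nonsing_inv_mul _ hu, Matrix.one_mulVec, add_dotProduct, dotProduct_sub,
    ← inner_eq_dotProduct a S θ hi, ← inner_eq_dotProduct a S θ hj]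
  congr 1
  rw [← Matrix.vecMul_transpose, hsymm, ← Matrix.dotProduct_mulVec, sum_dotProduct]
  refine Finset.sum_congr rfl fun m _ => ?_
  rw [sum_dotProduct]
  refine Finset.sum_congr rfl fun s _ => ?_
  rw [smul_dotProduct, smul_eq_mul, mul_comm]
  rfl

/-- With `z = V⁻¹ y`, the right-hand side is `zᵀ V z`, and `V` is the sum of the rank-one matrices
of the plays. -/
theorem sum_noiseCoeff_sq (hb : 0 < roundBudget K T) {B : Finset V} (hB : B.Nonempty)
    (i j : Fin K) :
    ∑ m ∈ B, ∑ s, noiseCoeff R p S B j i m s ^ 2 =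
      (projArm a S j - projArm a S i) ⬝ᵥ
        ((serverV R B p S)⁻¹ *ᵥ (projArm a S j - projArm a S i)) := by
  have hu := isUnit_det_serverV R hp hS hb hB
  set y := projArm a S j - projArm a S i
  set z := (serverV R B p S)⁻¹ *ᵥ y with hz
  have hy : y = serverV R B p S *ᵥ z := by
    rw [hz, Matrix.mulVec_mulVec, Matrix.mul_nonsing_inv _ hu, Matrix.one_mulVec]
  rw [hy]
  simp only [serverV, agentV, Matrix.sum_mulVec, sum_dotProduct]
  refine Finset.sum_congr rfl fun m _ => Finset.sum_congr rfl fun s _ => ?_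
  rw [Matrix.vecMulVec_mulVec]
  simp only [noiseCoeff, op_smul_eq_smul, smul_dotProduct, smul_eq_mul]
  exact sq _

theorem noise_variance_eq (B : Finset V) (y : Fin (armRank a S) → ℝ) :
    y ⬝ᵥ ((serverV R B p S)⁻¹ *ᵥ y) = ((B.card : ℝ) * roundBudget K T)⁻¹ *
      (y ⬝ᵥ ((designMatrix a S (R.design p S))⁻¹ *ᵥ y)) := by
  have h : ((((B.card : ℝ) * roundBudget K T) • designMatrix a S (R.design p S))⁻¹) =
      ((B.card : ℝ) * roundBudget K T)⁻¹ • (designMatrix a S (R.design p S))⁻¹ := by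
    -- In the degenerate case both sides vanish, since `0⁻¹ = 0` for reals and matrices.
    by_cases h0 : (B.card : ℝ) * roundBudget K T = 0
    · rw [h0]; simp
    · have := (R.design_spec p hp S hS).1.nonsingular
      have e := Matrix.inv_smul' (A := designMatrix a S (R.design p S))
        (Units.mk0 _ h0) this
      simpa [Units.smul_def] using e
  rw [serverV_eq R hp hS, h, Matrix.smul_mulVec, dotProduct_smul, smul_eq_mul]

theorem design_quadForm_sub_le {i j : Fin K} (hi : i ∈ S) (hj : j ∈ S) :
    (projArm a S j - projArm a S i) ⬝ᵥ ((designMatrix a S (R.design p S))⁻¹ *ᵥ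
      (projArm a S j - projArm a S i)) ≤ 8 * d := by
  have hspec := R.design_spec p hp S hS
  have hle := dotProduct_sub_le hspec.1.posDef.inv.posSemidef (projArm a S j) (projArm a S i)
  have h1 := hspec.armNormSq_le a S hi
  have h2 := hspec.armNormSq_le a S hj
  have hr : (armRank a S : ℝ) ≤ d := by exact_mod_cast armRank_le a S
  unfold armNormSq at h1 h2
  linarith

/-- If the budget of a round is `1`, then only one arm is played, and the active arms are multiples
of it. -/
theorem exists_multiples_of_budget_eq_one (hb : roundBudget K T = 1) (m : V)
    {k l : Fin K} (hk : k ∈ S) (hl : l ∈ S) (hkl : inner ℝ θ (a k) ≠ inner ℝ θ (a l)) :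
    ∃ s ∈ S, ∃ c : Fin K → ℝ, c s = 1 ∧ (∀ i ∈ S, c i ^ 2 ≤ 2) ∧
      (∀ i ∈ S, inner ℝ θ (a i) = c i * inner ℝ θ (a s)) ∧
      ∀ i j, (projArm a S j - projArm a S i) ⬝ᵥ ((designMatrix a S (R.design p S))⁻¹ *ᵥ
        (projArm a S j - projArm a S i)) = (c j - c i) ^ 2 := by
  have hspec := R.design_spec p hp S hS
  have hu := hspec.1.nonsingular
  set A := designMatrix a S (R.design p S) with hAdef
  set s := R.play m p S ⟨0, hb ▸ one_pos⟩ with hs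
  have hsS : s ∈ S := play_mem R hp hS m _
  set q := projArm a S s
  have hA : A = Matrix.vecMulVec q q := by
    have h := agentV_eq R hp hS m
    rw [hb, Nat.cast_one, one_smul] at h
    rw [hAdef, ← h, agentV, Finset.sum_eq_single_of_mem ⟨0, hb ▸ one_pos⟩ (Finset.mem_univ _)]
    intro t _ ht
    exact absurd (Fin.ext (by have := t.2; simp only; omega)) ht
  -- A nonsingular matrix of rank at most one has size at most one.
  have hrank : armRank a S ≤ 1 := by
    have h1 := Matrix.rank_of_isUnit A ((Matrix.isUnit_iff_isUnit_det A).2 hu)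
    rw [Fintype.card_fin] at h1
    rw [← h1, hA]
    exact Matrix.rank_vecMulVec_le q q
  set c : Fin K → ℝ := fun i => q ⬝ᵥ (A⁻¹ *ᵥ projArm a S i) with hc
  have hmul : ∀ i, projArm a S i = c i • q := by
    intro i
    have h : A *ᵥ (A⁻¹ *ᵥ projArm a S i) = projArm a S i := by
      rw [Matrix.mulVec_mulVec, Matrix.mul_nonsing_inv _ hu, Matrix.one_mulVec]
    rw [← h]
    nth_rewrite 1 [hA]
    rw [Matrix.vecMulVec_mulVec, op_smul_eq_smul]
  have hin : ∀ i ∈ S, inner ℝ θ (a i) = c i * inner ℝ θ (a s) := by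
    intro i hi
    rw [inner_eq_dotProduct a S θ hi, inner_eq_dotProduct a S θ hsS, hmul i, dotProduct_smul,
      smul_eq_mul]
  have hcs : c s = 1 := by
    -- Rank 0, where the empty matrix counts as nonsingular, is excluded by `hkl`.
    have hq : q ≠ 0 := by
      intro h0
      apply hkl
      rw [hin k hk, hin l hl, inner_eq_dotProduct a S θ hsS]
      change _ * (_ ⬝ᵥ q) = _ * (_ ⬝ᵥ q)
      simp [h0]
    have h : c s • q = (1 : ℝ) • q := by rw [one_smul]; exact (hmul s).symm
    exact smul_left_injective ℝ hq h
  have hqq : q ⬝ᵥ (A⁻¹ *ᵥ q) = 1 := hcs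
  refine ⟨s, hsS, c, hcs, fun i hi => ?_, hin, fun i j => ?_⟩
  · have h := hspec.armNormSq_le a S hi
    rw [armNormSq, ← hAdef, hmul i, smul_dotProduct, Matrix.mulVec_smul, dotProduct_smul, hqq] at h
    have hr : (armRank a S : ℝ) ≤ 1 := by exact_mod_cast hrank
    simp only [smul_eq_mul, mul_one] at h
    nlinarith
  · rw [hmul i, hmul j, ← sub_smul, smul_dotProduct, Matrix.mulVec_smul, dotProduct_smul, hqq]
    simp only [smul_eq_mul, mul_one]
    ring

/-- The variance of the estimated difference to the best arm, compared with the gap. -/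
theorem noise_variance_le (hK : 2 ≤ K) (hT : rounds K ≤ T)
    {best : Fin K} (hbest : ∀ i, i ≠ best → inner ℝ θ (a i) < inner ℝ θ (a best))
    {B : Finset V} (hB : B.Nonempty) (hbS : best ∈ S) {j : Fin K} (hj : j ∈ S) (hjb : j ≠ best) :
    ((projArm a S j - projArm a S best) ⬝ᵥ
      ((serverV R B p S)⁻¹ *ᵥ (projArm a S j - projArm a S best))) * (T * minGap a θ best ^ 2) ≤
      16 * d * Real.logb 2 K * (inner ℝ θ (a best) - inner ℝ θ (a j)) ^ 2 := by
  rw [noise_variance_eq R hp hS]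
  have hN : (1 : ℝ) ≤ B.card := by exact_mod_cast hB.card_pos
  have hb : (1 : ℝ) ≤ roundBudget K T := by exact_mod_cast roundBudget_pos hK hT
  have hgap := minGap_pos a θ best hK hbest
  have hgj := minGap_le a θ best hjb
  have hgj2 : minGap a θ best ^ 2 ≤ (inner ℝ θ (a best) - inner ℝ θ (a j)) ^ 2 := by gcongr
  have hlog := one_le_logb hK
  have hd : (1 : ℝ) ≤ d := by
    rcases Nat.eq_zero_or_pos d with rfl | h
    · exact absurd (hbest j hjb) (by rw [Subsingleton.elim (a j) (a best)]; exact lt_irrefl _)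
    · exact_mod_cast h
  rcases budget_bound hK hT with h | ⟨hb1, hTlog⟩
  -- The constant is `16 = 8 * 2`: `8 * d` from the quadratic form and `2` from the budget. The
  -- factor `b` cancels.
  · have hQ := design_quadForm_sub_le R hp hS hbS hj
    set Q := (projArm a S j - projArm a S best) ⬝ᵥ ((designMatrix a S (R.design p S))⁻¹ *ᵥ
      (projArm a S j - projArm a S best))
    rw [mul_assoc, inv_mul_le_iff₀ (by positivity)]
    calc Q * (T * minGap a θ best ^ 2)
        ≤ (8 * d) * ((2 * roundBudget K T * Real.logb 2 K) *
            (inner ℝ θ (a best) - inner ℝ θ (a j)) ^ 2) := by gcongr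
      _ = 1 * roundBudget K T *
            (16 * d * Real.logb 2 K * (inner ℝ θ (a best) - inner ℝ θ (a j)) ^ 2) := by ring
      _ ≤ _ := by gcongr
  · obtain ⟨m, -⟩ := hB
    obtain ⟨s, hsS, c, hcs, hc2, hin, hQ⟩ :=
      exists_multiples_of_budget_eq_one R θ hp hS hb1 m hbS hj (hbest j hjb).ne'
    rw [hQ, hb1, Nat.cast_one, mul_one]
    set t : ℝ := inner ℝ θ (a s)
    -- The smallest gap is compared with the gap between the played arm `s` and another arm: `j` if
    -- `s = best`, and `best` otherwise. The 6 bounds `(1 + √2) ^ 2`; in `aux`, `7 / 5` approximates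
    -- `√2`.
    have hkey : minGap a θ best ^ 2 ≤ 6 * t ^ 2 := by
      have aux : ∀ x : ℝ, x ^ 2 ≤ 2 → (1 - x) ^ 2 ≤ 6 := fun x hx => by
        nlinarith [sq_nonneg (5 * x + 7)]
      rcases eq_or_ne s best with hsb | hsb
      · calc minGap a θ best ^ 2 ≤ (inner ℝ θ (a best) - inner ℝ θ (a j)) ^ 2 := hgj2
          _ = (1 - c j) ^ 2 * t ^ 2 := by rw [hin best hbS, hin j hj, ← hsb, hcs]; ring
          _ ≤ 6 * t ^ 2 := by gcongr; exact aux _ (hc2 j hj)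
      · calc minGap a θ best ^ 2 ≤ (inner ℝ θ (a best) - inner ℝ θ (a s)) ^ 2 := by
              have := minGap_le a θ best hsb
              gcongr
          _ = (1 - c best) ^ 2 * t ^ 2 := by rw [hin best hbS]; ring
          _ ≤ 6 * t ^ 2 := by gcongr; exact aux _ (hc2 best hbS)
    calc (B.card : ℝ)⁻¹ * (c j - c best) ^ 2 * (T * minGap a θ best ^ 2)
        ≤ 1 * (c j - c best) ^ 2 * (T * (6 * t ^ 2)) := by
          gcongr
          exact inv_le_one_of_one_le₀ hN
      _ = (6 * T) * ((c j - c best) ^ 2 * t ^ 2) := by ring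
      _ ≤ (16 * d * Real.logb 2 K) * ((c j - c best) ^ 2 * t ^ 2) := by
          refine mul_le_mul_of_nonneg_right ?_ (by positivity)
          nlinarith
      _ = _ := by rw [hin best hbS, hin j hj]; ring

end Star

open MeasureTheory ProbabilityTheory

/-! ### Counting events -/

/-- Markov's inequality for the number of events that occur. -/
theorem card_mul_measureReal_le {Ω ι : Type*} [MeasurableSpace Ω] {μ : Measure Ω}
    [IsFiniteMeasure μ] {s : Finset ι} {E : ι → Set Ω} (hE : ∀ i ∈ s, MeasurableSet (E i))
    {A : Set Ω} {n : ℕ} (hA : ∀ ω ∈ A, ∃ t ⊆ s, n ≤ t.card ∧ ∀ i ∈ t, ω ∈ E i) :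
    n * μ.real A ≤ ∑ i ∈ s, μ.real (E i) := by
  have hmeas : ∀ i ∈ s, Measurable ((E i).indicator (1 : Ω → ENNReal)) := fun i hi =>
    measurable_one.indicator (hE i hi)
  -- `A` need not be measurable: only monotonicity of the outer measure is used for it.
  have hsub : A ⊆ {ω | (n : ENNReal) ≤ ∑ i ∈ s, (E i).indicator 1 ω} := by
    intro ω hω
    obtain ⟨t, hts, hn, ht⟩ := hA ω hω
    calc (n : ENNReal) ≤ t.card := by exact_mod_cast hn
      _ = ∑ i ∈ t, (E i).indicator 1 ω := by
        rw [Finset.sum_congr rfl fun i hi => Set.indicator_of_mem (ht i hi) 1]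
        simp
      _ ≤ ∑ i ∈ s, (E i).indicator 1 ω := Finset.sum_le_sum_of_subset hts
  have h : (n : ENNReal) * μ A ≤ ∑ i ∈ s, μ (E i) :=
    calc (n : ENNReal) * μ A
        ≤ n * μ {ω | (n : ENNReal) ≤ ∑ i ∈ s, (E i).indicator 1 ω} := by gcongr
      _ ≤ ∫⁻ ω, ∑ i ∈ s, (E i).indicator 1 ω ∂μ :=
        mul_meas_ge_le_lintegral (Finset.measurable_sum s hmeas) _
      _ = ∑ i ∈ s, μ (E i) := by
        rw [lintegral_finsetSum s hmeas]
        exact Finset.sum_congr rfl fun i hi => lintegral_indicator_one (hE i hi)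
  have h' := ENNReal.toReal_mono
    (ENNReal.sum_ne_top.2 fun i _ => measure_ne_top μ (E i)) h
  rwa [ENNReal.toReal_mul, ENNReal.toReal_natCast,
    ENNReal.toReal_sum fun i _ => measure_ne_top μ (E i)] at h'

/-! ### Tail bound -/

theorem measureReal_weighted_sum_ge_le {Ω ι : Type*} [MeasurableSpace Ω] {μ : Measure Ω}
    {X : ι → Ω → ℝ} (hX : iIndepFun X μ)
    (hsub : ∀ i, HasSubgaussianMGF (X i) 1 μ) (s : Finset ι) (u : ι → ℝ) {c ε : ℝ}
    (hc : ∑ i ∈ s, u i ^ 2 ≤ c) (hε : 0 ≤ ε) :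
    μ.real {ω | ε ≤ ∑ i ∈ s, u i * X i ω} ≤ Real.exp (-ε ^ 2 / (2 * c)) := by
  have hind : iIndepFun (fun i ω => u i * X i ω) μ :=
    hX.comp (fun i x => u i * x) fun i => measurable_const_mul (u i)
  have h := HasSubgaussianMGF.sum_of_iIndepFun hind (s := s) fun i _ => (hsub i).const_mul (u i)
  have hc0 : 0 ≤ c := (Finset.sum_nonneg fun i _ => sq_nonneg (u i)).trans hc
  have h' : HasSubgaussianMGF (fun ω => ∑ i ∈ s, u i * X i ω) ⟨c, hc0⟩ μ := by
    refine ⟨h.integrable_exp_mul, fun t => (h.mgf_le t).trans (Real.exp_le_exp.2 ?_)⟩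
    have hle : ((∑ i ∈ s, NNReal.mk (u i ^ 2) (sq_nonneg (u i)) * 1 : NNReal) : ℝ) ≤ c := by
      push_cast
      simpa using hc
    have := mul_le_mul_of_nonneg_right hle (sq_nonneg t)
    change _ ≤ c * t ^ 2 / 2
    exact div_le_div_of_nonneg_right this zero_le_two
  exact h'.measure_ge_le hε

/-! ### One run of MaLinBAI-Star -/

/-! ### Dependence of active sets and estimates on the noise -/

section Measurability

variable {V : Type*} {d K T : ℕ} {a : Fin K → EuclideanSpace ℝ (Fin d)} {Ω : Type*}
  (R : StarRules V a T) (θ : EuclideanSpace ℝ (Fin d)) (η : V → ℕ → Ω → ℝ)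

/-- Only noise of round `p` is assumed measurable, so that this applies to the σ-algebras
`noiseSigma` as well. -/
theorem measurable_estimate [MeasurableSpace Ω] (B : Finset V) (p : ℕ) (S : Finset (Fin K))
    (h : ∀ m, ∀ s : Fin (roundBudget K T), Measurable (η m (p * roundBudget K T + s))) :
    Measurable fun ω => estimate R θ η B p S ω := by
  have hD : ∀ k, Measurable fun ω => serverD R θ η B p S ω k := by
    intro k
    simp only [serverD, agentD, reward, Finset.sum_apply, Pi.smul_apply, smul_eq_mul]
    fun_prop
  refine measurable_pi_lambda _ fun i => ?_
  simp only [estimate, thetaHat, dotProduct, Matrix.mulVec]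
  fun_prop

/-- The σ-algebra generated by the noise at the times in `I`. -/
@[reducible]
def noiseSigma (I : Set ℕ) : MeasurableSpace Ω :=
  ⨆ q ∈ {q : V × ℕ | q.2 ∈ I}, MeasurableSpace.comap (η q.1 q.2) inferInstance

theorem measurable_noiseSigma {I : Set ℕ} (m : V) {t : ℕ} (ht : t ∈ I) :
    Measurable[noiseSigma η I] (η m t) := by
  refine Measurable.mono (comap_measurable (η m t)) ?_ le_rfl
  exact le_iSup₂_of_le (f := fun (q : V × ℕ) (_ : q ∈ {q : V × ℕ | q.2 ∈ I}) =>
    MeasurableSpace.comap (η q.1 q.2) inferInstance) (m, t) ht le_rfl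

theorem noiseSigma_mono {I J : Set ℕ} (h : I ⊆ J) : noiseSigma η I ≤ noiseSigma η J :=
  biSup_mono fun _ hq => h hq

theorem noiseSigma_le [mΩ : MeasurableSpace Ω] (hη : ∀ m t, Measurable (η m t)) (I : Set ℕ) :
    noiseSigma η I ≤ mΩ :=
  iSup₂_le fun q _ => (hη q.1 q.2).comap_le

theorem indep_noiseSigma [MeasurableSpace Ω] {μ : Measure Ω} (hη : ∀ m t, Measurable (η m t))
    (hind : iIndepFun (fun q : V × ℕ => η q.1 q.2) μ) {I J : Set ℕ} (hIJ : Disjoint I J) :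
    Indep (noiseSigma η I) (noiseSigma η J) μ :=
  indep_iSup_of_disjoint (m := fun q : V × ℕ => MeasurableSpace.comap (η q.1 q.2) inferInstance)
    (fun q => (hη q.1 q.2).comap_le) ((iIndepFun_iff_iIndep _ _ _).1 hind)
    (Set.disjoint_left.2 fun _ h1 h2 => Set.disjoint_left.1 hIJ h1 h2)

/-- Splitting over the finitely many possible previous active sets leaves estimates for a fixed set,
which use only the noise of the latest round. -/
theorem measurableSet_active_eq (B : Finset V) (p : ℕ) (S : Finset (Fin K)) :
    MeasurableSet[noiseSigma η (Set.Iio (p * roundBudget K T))]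
      {ω | active R θ η B p ω = S} := by
  induction p generalizing S with
  | zero =>
    simp only [active]
    exact @MeasurableSet.const _ (noiseSigma η _) _
  | succ p ih =>
    have hEq : {ω | active R θ η B (p + 1) ω = S} = ⋃ S' : Finset (Fin K),
        {ω | active R θ η B p ω = S'} ∩
          (fun ω => estimate R θ η B p S' ω) ⁻¹' {x | R.keep p S' x = S} := by
      ext ω
      simp [active]
    rw [hEq]
    refine @MeasurableSet.iUnion _ _ (noiseSigma η _) _ _ fun S' =>
      @MeasurableSet.inter _ (noiseSigma η _) _ _ ?_ ?_
    · refine noiseSigma_mono η (Set.Iio_subset_Iio ?_) _ (ih S')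
      exact Nat.mul_le_mul_right _ p.le_succ
    · refine @measurable_estimate _ _ _ _ _ _ R θ η (noiseSigma η _) B p S' (fun m s => ?_) _
        (R.keep_measurable p S' S)
      refine measurable_noiseSigma η m ?_
      rw [Set.mem_Iio, Nat.succ_mul]
      exact Nat.add_lt_add_left s.2 _

theorem card_active {B : Finset V} {p : ℕ} (hp : p ≤ rounds K) (ω : Ω) :
    (active R θ η B p ω).card = activeCard K p := by
  induction p with
  | zero => simp [active, activeCard_zero]
  | succ p ih => exact R.keep_card p hp _ (ih (Nat.le_of_succ_le hp)) _

end Measurability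

/-! ### Error probability of one run -/

section Star

variable {V : Type*} {d K T : ℕ} {a : Fin K → EuclideanSpace ℝ (Fin d)} {Ω : Type*}
  [MeasurableSpace Ω] {μ : Measure Ω} [IsProbabilityMeasure μ]
  (R : StarRules V a T) {θ : EuclideanSpace ℝ (Fin d)} {η : V → ℕ → Ω → ℝ}
  (hK : 2 ≤ K) (hT : rounds K ≤ T)
  {best : Fin K} (hbest : ∀ i, i ≠ best → inner ℝ θ (a i) < inner ℝ θ (a best))
  (hmeas : ∀ m t, Measurable (η m t))
  (hindep : iIndepFun (fun q : V × ℕ => η q.1 q.2) μ)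
  (hsub : ∀ m t, HasSubgaussianMGF (η m t) 1 μ)
  {B : Finset V} (hB : B.Nonempty)

omit [IsProbabilityMeasure μ] in
include hK hT hbest hindep hsub hB in
/-- An arm of a fixed active set is rarely estimated to be better than the best arm. -/
theorem measureReal_estimate_le_estimate {p : ℕ} (hp : p < rounds K) {S : Finset (Fin K)}
    (hS : S.card = activeCard K p) (hbS : best ∈ S) {j : Fin K} (hj : j ∈ S) (hjb : j ≠ best) :
    μ.real {ω | estimate R θ η B p S ω best ≤ estimate R θ η B p S ω j} ≤
      Real.exp (-(T * minGap a θ best ^ 2) / (32 * d * Real.logb 2 K)) := by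
  have hb := roundBudget_pos hK hT
  have hgap := minGap_pos a θ best hK hbest
  have hlog := one_le_logb hK
  have hTpos : (0 : ℝ) < T := by exact_mod_cast (rounds_pos hK).trans_le hT
  -- In dimension 0 all arms coincide, so `best` could not be strictly better.
  have hd : (0 : ℝ) < d := by
    rcases Nat.eq_zero_or_pos d with rfl | h
    · exact absurd (hbest j hjb) (by rw [Subsingleton.elim (a j) (a best)]; exact lt_irrefl _)
    · exact_mod_cast h
  set ε : ℝ := inner ℝ θ (a best) - inner ℝ θ (a j) with hε
  have hεpos : 0 < ε := sub_pos.2 (hbest j hjb)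
  have hle := noise_variance_le R θ hp hS hK hT hbest hB hbS hj hjb
  rw [← sum_noiseCoeff_sq R hp hS hb hB, ← le_div_iff₀ (by positivity)] at hle
  set c := 16 * d * Real.logb 2 K * ε ^ 2 / (T * minGap a θ best ^ 2) with hc
  have hinj : Function.Injective fun q : V × Fin (roundBudget K T) =>
      ((q.1, p * roundBudget K T + q.2) : V × ℕ) := by
    rintro ⟨m, s⟩ ⟨m', s'⟩ h
    simp only [Prod.mk.injEq, Nat.add_left_cancel_iff] at h
    exact Prod.ext h.1 (Fin.ext h.2)
  have htail := measureReal_weighted_sum_ge_le (μ := μ)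
    (X := fun (q : V × Fin (roundBudget K T)) => η q.1 (p * roundBudget K T + q.2))
    (hindep.precomp hinj) (fun q => hsub _ _) (B ×ˢ Finset.univ)
    (fun q => noiseCoeff R p S B j best q.1 q.2) (c := c) (ε := ε)
    (by rwa [Finset.sum_product]) hεpos.le
  -- The order is reversed exactly when the noise makes up for the gap `ε`.
  have hset : {ω | estimate R θ η B p S ω best ≤ estimate R θ η B p S ω j} =
      {ω | ε ≤ ∑ q ∈ B ×ˢ (Finset.univ : Finset (Fin (roundBudget K T))),
        noiseCoeff R p S B j best q.1 q.2 * η q.1 (p * roundBudget K T + q.2) ω} := by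
    ext ω
    have := estimate_sub_estimate R θ η hp hS hb hB hbS hj ω
    rw [Set.mem_ofPred_eq, Set.mem_ofPred_eq, Finset.sum_product]
    constructor <;> intro h <;> linarith
  rw [hset]
  refine htail.trans_eq ?_
  rw [hc]
  congr 1
  field_simp
  norm_num

include hK hT hbest hmeas hindep hsub hB in
/-- In one round, the best arm is rarely eliminated. -/
theorem measureReal_eliminated_le {p : ℕ} (hp : p < rounds K) :
    μ.real {ω | best ∈ active R θ η B p ω ∧ best ∉ active R θ η B (p + 1) ω} ≤
      2 * Real.exp (-(T * minGap a θ best ^ 2) / (32 * d * Real.logb 2 K)) := by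
  set ρ := Real.exp (-(T * minGap a θ best ^ 2) / (32 * d * Real.logb 2 K)) with hρ
  have hρ0 : 0 ≤ ρ := (Real.exp_pos _).le
  have hpast := noiseSigma_le η hmeas (Set.Iio (p * roundBudget K T))
  have hfut := noiseSigma_le η hmeas (Set.Ici (p * roundBudget K T))
  have hn : (0 : ℝ) < activeCard K (p + 1) := by exact_mod_cast activeCard_pos hK _
  have hAm : ∀ S, MeasurableSet {ω | active R θ η B p ω = S} := fun S =>
    hpast _ (measurableSet_active_eq R θ η B p S)
  -- The bound is proved jointly with each value `S` of the active set and then summed over `S`;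
  -- this plays the role of conditioning and avoids dividing by probabilities.
  have hfix : ∀ S : Finset (Fin K),
      μ.real {ω | active R θ η B p ω = S ∧ best ∈ S ∧ best ∉ active R θ η B (p + 1) ω} ≤
        2 * ρ * μ.real {ω | active R θ η B p ω = S} := by
    intro S
    by_cases hbS : best ∈ S
    swap
    · simp only [hbS, false_and, and_false]
      rw [show {ω : Ω | False} = ∅ from rfl, measureReal_empty]
      positivity
    by_cases hS : S.card = activeCard K p
    swap
    · have : {ω | active R θ η B p ω = S ∧ best ∈ S ∧ best ∉ active R θ η B (p + 1) ω} = ∅ := by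
        ext ω
        simp only [Set.mem_ofPred_eq, Set.mem_empty_iff_false, iff_false]
        rintro ⟨h, -⟩
        exact hS (h ▸ card_active R θ η hp.le ω)
      rw [this, measureReal_empty]
      positivity
    have hEm : ∀ j, MeasurableSet[noiseSigma η (Set.Ici (p * roundBudget K T))]
        {ω | estimate R θ η B p S ω best ≤ estimate R θ η B p S ω j} := by
      intro j
      exact @measurable_estimate _ _ _ _ _ _ R θ η (noiseSigma η _) B p S
        (fun m s => measurable_noiseSigma η m (Set.mem_Ici.2 (Nat.le_add_right _ s)))
        {x | x best ≤ x j} (measurableSet_le (measurable_pi_apply best) (measurable_pi_apply j))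
    -- If `best` is dropped, every kept arm beats or ties it. A union bound would cost the number of
    -- arms; Markov's inequality costs only the ratio of candidates to kept arms, at most 2.
    have hcount := card_mul_measureReal_le (μ := μ) (s := S.erase best)
      (E := fun j => {ω | active R θ η B p ω = S} ∩
        {ω | estimate R θ η B p S ω best ≤ estimate R θ η B p S ω j})
      (A := {ω | active R θ η B p ω = S ∧ best ∈ S ∧ best ∉ active R θ η B (p + 1) ω})
      (n := activeCard K (p + 1))
      (fun j _ => (hAm S).inter (hfut _ (hEm j))) (by
        rintro ω ⟨h1, -, h2⟩
        simp only [active, h1] at h2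
        refine ⟨R.keep p S (estimate R θ η B p S ω), fun j hj => ?_,
          (R.keep_card p hp S hS _).ge, fun j hj => ?_⟩
        · exact Finset.mem_erase.2 ⟨fun h => h2 (h ▸ hj), R.keep_subset p hp S hS _ hj⟩
        · exact ⟨h1, R.keep_top p hp S hS _ j hj best hbS h2⟩)
    have hterm : ∀ j ∈ S.erase best, μ.real ({ω | active R θ η B p ω = S} ∩
        {ω | estimate R θ η B p S ω best ≤ estimate R θ η B p S ω j}) ≤
          μ.real {ω | active R θ η B p ω = S} * ρ := by
      intro j hj
      obtain ⟨hjb, hjS⟩ := Finset.mem_erase.1 hj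
      -- The active set uses times before `p * b`, the estimates for the fixed `S` use times from `p
      -- * b` on.
      have hind := (Indep_iff _ _ _).1 (indep_noiseSigma η hmeas hindep
        (Set.Iio_disjoint_Ici (le_refl (p * roundBudget K T)))) _ _
        (measurableSet_active_eq R θ η B p S) (hEm j)
      rw [measureReal_def, hind, ENNReal.toReal_mul]
      exact mul_le_mul_of_nonneg_left
        (measureReal_estimate_le_estimate R hK hT hbest hindep hsub hB hp hS hbS hjS hjb)
        ENNReal.toReal_nonneg
    have hsum := hcount.trans (Finset.sum_le_sum hterm)
    rw [Finset.sum_const, nsmul_eq_mul] at hsum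
    have hcard : ((S.erase best).card : ℝ) ≤ 2 * activeCard K (p + 1) := by
      have h1 := Finset.card_erase_le (s := S) (a := best)
      have h2 := activeCard_le_two_mul K p
      exact_mod_cast h1.trans (hS ▸ h2)
    refine le_of_mul_le_mul_left (hsum.trans ?_) hn
    calc ((S.erase best).card : ℝ) * (μ.real {ω | active R θ η B p ω = S} * ρ)
        ≤ (2 * activeCard K (p + 1)) * (μ.real {ω | active R θ η B p ω = S} * ρ) := by gcongr
      _ = _ := by ring
  have hcover : {ω | best ∈ active R θ η B p ω ∧ best ∉ active R θ η B (p + 1) ω} ⊆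
      ⋃ S ∈ (Finset.univ : Finset (Finset (Fin K))),
        {ω | active R θ η B p ω = S ∧ best ∈ S ∧ best ∉ active R θ η B (p + 1) ω} := by
    intro ω hω
    simp only [Finset.mem_univ, Set.iUnion_true, Set.mem_iUnion]
    exact ⟨active R θ η B p ω, rfl, hω⟩
  have htotal : ∑ S : Finset (Fin K), μ.real {ω | active R θ η B p ω = S} = 1 := by
    rw [← measureReal_biUnion_finset _ (fun S _ => hAm S)]
    · rw [← probReal_univ (μ := μ)]
      congr 1
      ext ω
      simp
    · intro S _ S' _ hSS'
      exact Set.disjoint_left.2 fun ω h1 h2 => hSS' (h1.symm.trans h2)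
  calc _ ≤ μ.real (⋃ S ∈ (Finset.univ : Finset (Finset (Fin K))),
        {ω | active R θ η B p ω = S ∧ best ∈ S ∧ best ∉ active R θ η B (p + 1) ω}) :=
        measureReal_mono hcover (measure_ne_top _ _)
    _ ≤ ∑ S : Finset (Fin K),
        μ.real {ω | active R θ η B p ω = S ∧ best ∈ S ∧ best ∉ active R θ η B (p + 1) ω} :=
        measureReal_biUnion_finset_le _ _
    _ ≤ ∑ S : Finset (Fin K), 2 * ρ * μ.real {ω | active R θ η B p ω = S} :=
        Finset.sum_le_sum fun S _ => hfix S
    _ = 2 * ρ := by rw [← Finset.mul_sum, htotal, mul_one]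

include hK hT hbest hmeas hindep hsub hB in
/-- The error probability of MaLinBAI-Star. -/
theorem measureReal_not_starReturns_le :
    μ.real {ω | ¬ StarReturns R θ η B ω best} ≤ 4 * Real.logb 2 K *
      Real.exp (-(T * minGap a θ best ^ 2) / (32 * d * Real.logb 2 K)) := by
  have hcover : {ω | ¬ StarReturns R θ η B ω best} ⊆ ⋃ p ∈ Finset.range (rounds K),
      {ω | best ∈ active R θ η B p ω ∧ best ∉ active R θ η B (p + 1) ω} := by
    intro ω hω
    by_contra hcon
    simp only [Set.mem_iUnion, Finset.mem_range, Set.mem_ofPred_eq, not_exists, not_and,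
      not_not] at hcon
    have hmem : ∀ p ≤ rounds K, best ∈ active R θ η B p ω := by
      intro p
      induction p with
      | zero => exact fun _ => Finset.mem_univ _
      | succ p ih => exact fun hp => hcon p hp (ih (Nat.le_of_succ_le hp))
    obtain ⟨i, hi⟩ := Finset.card_eq_one.1
      ((card_active R θ η (B := B) le_rfl ω).trans (activeCard_rounds hK))
    have := hmem _ le_rfl
    rw [hi, Finset.mem_singleton] at this
    exact hω (this ▸ hi)
  refine (measureReal_mono hcover (measure_ne_top _ _)).trans ((measureReal_biUnion_finset_le _ _).trans
    ((Finset.sum_le_sum fun p hp => measureReal_eliminated_le R hK hT hbest hmeas hindep hsub hB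
      (Finset.mem_range.1 hp)).trans ?_))
  rw [Finset.sum_const, Finset.card_range, nsmul_eq_mul]
  have := mul_le_mul_of_nonneg_right (rounds_le hK)
    (Real.exp_pos (-(T * minGap a θ best ^ 2) / (32 * d * Real.logb 2 K))).le
  linarith

omit [IsProbabilityMeasure μ] in
include hmeas in
theorem measurableSet_not_starReturns (B : Finset V) :
    MeasurableSet {ω | ¬ StarReturns R θ η B ω best} :=
  (noiseSigma_le η hmeas _ _ (measurableSet_active_eq R θ η B (rounds K) {best})).compl

end Star

/-! ### MaLinBAI-Gen -/

section Gen

variable {V : Type*} [Fintype V] [DecidableEq V] {d K T : ℕ}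
  {a : Fin K → EuclideanSpace ℝ (Fin d)} {Ω : Type*}
  {P : Finpartition (Finset.univ : Finset V)} (R : P.parts → StarRules V a T)
  (θ : EuclideanSpace ℝ (Fin d)) (η : V → ℕ → Ω → ℝ)

open Classical in
/-- If a most frequent arm differs from `i`, then at least half of the blocks do not return `i`. -/
theorem card_le_two_mul_card_not_starReturns {ω : Ω} {i j : Fin K}
    (hj : MostFrequent R θ η ω j) (hij : j ≠ i) :
    Fintype.card P.parts ≤ 2 * (Finset.univ.filter fun B : P.parts =>
      ¬ StarReturns (R B) θ η (B : Finset V) ω i).card := by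
  have h1 : votes R θ η ω i ≤ votes R θ η ω j := hj i
  have h2 : votes R θ η ω j ≤ (Finset.univ.filter fun B : P.parts =>
      ¬ StarReturns (R B) θ η (B : Finset V) ω i).card := by
    -- A block returns only one arm, so every vote for `j` is a block that does not return `i`.
    refine Finset.card_le_card (Finset.monotone_filter_right _ fun B _ hB hB' => hij ?_)
    exact Finset.singleton_injective (Eq.trans (Eq.symm hB) hB')
  have h3 := Finset.card_filter_add_card_filter_not (s := (Finset.univ : Finset P.parts))
    (fun B : P.parts => StarReturns (R B) θ η (B : Finset V) ω i)
  rw [Finset.card_univ] at h3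
  unfold votes at h1 h2
  omega

end Gen

end MaLinBAI

/-! ### The majority vote over the blocks -/

theorem theorem2 {V : Type*} [Fintype V] [DecidableEq V] [Nonempty V]
    (G : SimpleGraph V) (D : Finset V) (P : Finpartition (Finset.univ : Finset V))
    (hP : MaLinBAI.IsDominatingSetPartition G D P)
    {d K : ℕ} (hK : 2 ≤ K)
    (a : Fin K → EuclideanSpace ℝ (Fin d)) (ha : Function.Injective a)
    (θ : EuclideanSpace ℝ (Fin d)) (best : Fin K)
    (hbest : ∀ i, i ≠ best → inner ℝ θ (a i) < inner ℝ θ (a best))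
    (T : ℕ) (hT : MaLinBAI.rounds K ≤ T)
    {Ω : Type*} [MeasurableSpace Ω] (μ : MeasureTheory.Measure Ω)
    [MeasureTheory.IsProbabilityMeasure μ]
    (η : V → ℕ → Ω → ℝ)
    (hη_meas : ∀ m t, Measurable (η m t))
    (hη_indep : ProbabilityTheory.iIndepFun (fun q : V × ℕ => η q.1 q.2) μ)
    (hη_subgaussian : ∀ m t, ProbabilityTheory.HasSubgaussianMGF (η m t) 1 μ)
    (R : P.parts → MaLinBAI.StarRules V a T)
    (out : Ω → Fin K) (hout : ∀ ω, MaLinBAI.IsGenOutput R θ η ω (out ω)) :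
    μ.real {ω | out ω ≠ best} ≤
      8 * Real.logb 2 K *
        Real.exp (-(T * MaLinBAI.minGap a θ best ^ 2) / (32 * d * Real.logb 2 K)) := by
  classical
  have hM : (0 : ℝ) < Fintype.card P.parts := by
    obtain ⟨B, hB⟩ := P.parts_nonempty (Finset.univ_nonempty (α := V)).ne_empty
    have : Nonempty P.parts := ⟨⟨B, hB⟩⟩
    exact_mod_cast Fintype.card_pos
  -- every block is counted twice, so that the threshold is the integer `card P.parts`
  have hcount := MaLinBAI.card_mul_measureReal_le (μ := μ)
    (s := (Finset.univ : Finset (P.parts × Bool)))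
    (E := fun B => {ω | ¬ MaLinBAI.StarReturns (R B.1) θ η (B.1 : Finset V) ω best})
    (A := {ω | out ω ≠ best}) (n := Fintype.card P.parts)
    (fun B _ => MaLinBAI.measurableSet_not_starReturns (R B.1) hη_meas _) (by
      intro ω hω
      refine ⟨(Finset.univ.filter fun B : P.parts =>
        ¬ MaLinBAI.StarReturns (R B) θ η (B : Finset V) ω best) ×ˢ Finset.univ,
        Finset.subset_univ _, ?_, fun B hB => ?_⟩
      · rw [Finset.card_product, Finset.card_univ (α := Bool), Fintype.card_bool, mul_comm]
        exact MaLinBAI.card_le_two_mul_card_not_starReturns R θ η (hout ω).1 hω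
      · exact (Finset.mem_filter.1 (Finset.mem_product.1 hB).1).2)
  have hsum := hcount.trans (Finset.sum_le_sum fun B _ =>
    MaLinBAI.measureReal_not_starReturns_le (R B.1) hK hT hbest hη_meas hη_indep hη_subgaussian
      (P.nonempty_of_mem_parts B.1.2))
  rw [Finset.sum_const, Finset.card_univ, Fintype.card_prod, Fintype.card_bool, nsmul_eq_mul]
    at hsum
  -- The number of blocks occurs on both sides and cancels.
  refine le_of_mul_le_mul_left (hsum.trans_eq ?_) hM
  push_cast
  ring
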